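/- Let $\mathbb{D}=\{z\in\mathbb{C}:|z|<1\}$ and $\mathbb{D}_r=\{z:|z|<r\}$. Let $\mathcal{H}$ be the class of functions $f=h+\overline{g}$ on $\mathbb{D}$, where $h(z)=z+\sum_{n\ge2}\alpha_nz^n$ and $g(z)=\sum_{n\ge1}\beta_nz^n$ are analytic in $\mathbb{D}$ and $|h'|^2-|g'|^2>0$ on $\mathbb{D}$ (sense-preserving harmonic mappings). A function $f\in\mathcal{H}$ is called *hereditarily starlike* if it is univalent in $\mathbb{D}$ and maps every circle $|z|=r$, $0<r<1$, one-to-one onto a curve that bounds a domain starlike with respect to the origin. For a real number $\lambda$ with $|\lambda|<\pi/2$, a domain $\Omega$ containing the origin is called *$\lambda$-spirallike* if for each $w\in\Omega$ the arc $\{w\exp(-e^{i\lambda}t):t\ge0\}$ of the $\lambda$-spiral from the origin to $w$ lies in $\Omega$, and $f\in\mathcal{H}$ is called *hereditarily $\lambda$-spirallike* if $f$ is univalent in $\mathbb{D}$ and $f(\mathbb{D}_r)$ is a $\lambda$-spirallike domain for each $0<r<1$. Put $$A_n=\left|1+ne^{-i\lambda}\right|+\left|1-ne^{-i\lambda}\right|\quad(n\ge1),\qquad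 B=\left|1+e^{-i\lambda}\right|-\left|1-e^{-i\lambda}\right|.$$ **Theorem.** Let $\lambda\in(-\pi/2,\pi/2)$ and let $(a_n)_{n\ge2}$, $(b_n)_{n\ge1}$ be sequences of complex numbers such that the power series $\sum_{n\ge2}|a_n|z^n$ and $\sum_{n\ge1}|b_n|z^n$ converge in $\mathbb{D}$. 1. If $F(z)=z-\sum_{n=2}^\infty|a_n|z^n+\overline{\sum_{n=1}^\infty|b_n|z^n}$ is hereditarily starlike, and $(d_n)_{n\ge1}$ is a sequence of complex numbers with $|d_n|\le nB/A_n$ for all $n\ge1$, then the power series $\sum_{n\ge2}d_na_nz^n$ and $\sum_{n\ge1}d_nb_nz^n$ converge in $\mathbb{D}$ and $$f(z)=z+\sum_{n=2}^\infty d_na_nz^n+\overline{\sum_{n=1}^\infty d_nb_nz^n}$$ is hereditarily $\lambda$-spirallike. 2. Conversely, if $f(z)=z-\sum_{n=2}^\infty|a_n|z^n+\overline{\sum_{n=1}^\infty|b_n|z^n}$ is hereditarily $\lambda$-spirallike, then the power series $\sum_{n\ge2}a_nz^n$ and $\sum_{n\ge1}b_nz^n$ converge in $\mathbb{D}$ and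 $$F(z)=z+\sum_{n=2}^\infty a_nz^n+\overline{\sum_{n=1}^\infty b_nz^n}$$ is hereditarily starlike. -/

import Mathlib

noncomputable section

namespace HarmonicSpirallike

/-- The function `z + ∑_{n ≥ 2} a n * z ^ n + conj (∑_{n ≥ 1} b n * z ^ n)`.
The values `a 0`, `a 1`, `b 0` are not used. It is meaningful when both power series converge;
see `SeriesConverges`. -/
def harmonicSeries (a b : ℕ → ℂ) (z : ℂ) : ℂ :=
  z + ∑' n : ℕ, a (n + 2) * z ^ (n + 2)
    + (starRingEnd ℂ) (∑' n : ℕ, b (n + 1) * z ^ (n + 1))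

/-- Both power series in `harmonicSeries a b` converge in the whole open unit disk. -/
def SeriesConverges (a b : ℕ → ℂ) : Prop :=
  ∀ z ∈ Metric.ball (0 : ℂ) 1,
    Summable (fun n : ℕ => a (n + 2) * z ^ (n + 2)) ∧
    Summable (fun n : ℕ => b (n + 1) * z ^ (n + 1))

/-- The class of sense-preserving harmonic functions `f = h + conj g` in the unit disk, where
`h` and `g` are analytic in the unit disk with `h(z) = z + O(z^2)`, `g(0) = 0`, and the Jacobian
`|h'|^2 - |g'|^2` is positive. -/
def IsSensePreservingHarmonic (f : ℂ → ℂ) : Prop :=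
  ∃ h g : ℂ → ℂ,
    DifferentiableOn ℂ h (Metric.ball 0 1) ∧ DifferentiableOn ℂ g (Metric.ball 0 1) ∧
    h 0 = 0 ∧ deriv h 0 = 1 ∧ g 0 = 0 ∧
    (∀ z ∈ Metric.ball (0 : ℂ) 1, f z = h z + (starRingEnd ℂ) (g z)) ∧
    (∀ z ∈ Metric.ball (0 : ℂ) 1, 0 < ‖deriv h z‖ ^ 2 - ‖deriv g z‖ ^ 2)

/-- A domain: a (nonempty) open connected subset of the plane. -/
def IsDomainSet (Ω : Set ℂ) : Prop := IsOpen Ω ∧ IsConnected Ω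

/-- A domain containing the origin that contains, with each point, the segment from the origin
to that point. -/
def IsStarlikeDomain (Ω : Set ℂ) : Prop :=
  IsDomainSet Ω ∧ (0 : ℂ) ∈ Ω ∧ StarConvex ℝ 0 Ω

/-- A domain containing the origin that contains, with each point `w`, the arc
`w * exp (- e ^ (i lam) * t)`, `t ≥ 0`, of the logarithmic `lam`-spiral from the origin to `w`. -/
def IsSpirallikeDomain (lam : ℝ) (Ω : Set ℂ) : Prop :=
  IsDomainSet Ω ∧ (0 : ℂ) ∈ Ω ∧
    ∀ w ∈ Ω, ∀ t : ℝ, 0 ≤ t →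
      w * Complex.exp (-(Complex.exp (Complex.I * lam) * t)) ∈ Ω

/-- `f` maps every circle `|z| = r`, `0 < r < 1`, one-to-one onto a curve that bounds a domain
starlike with respect to the origin. -/
def IsFullyStarlike (f : ℂ → ℂ) : Prop :=
  ∀ r : ℝ, 0 < r → r < 1 →
    Set.InjOn f (Metric.sphere 0 r) ∧
    ∃ Ω : Set ℂ, IsStarlikeDomain Ω ∧ Bornology.IsBounded Ω ∧
      frontier Ω = f '' Metric.sphere 0 r

/-- Hereditarily starlike harmonic mappings: fully starlike and univalent. -/
def IsHereditarilyStarlike (f : ℂ → ℂ) : Prop :=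
  IsSensePreservingHarmonic f ∧ IsFullyStarlike f ∧ Set.InjOn f (Metric.ball 0 1)

/-- Hereditarily `lam`-spirallike harmonic mappings: univalent in the unit disk, and the image of
every disk `|z| < r`, `0 < r < 1`, is a `lam`-spirallike domain. -/
def IsHereditarilySpirallike (lam : ℝ) (f : ℂ → ℂ) : Prop :=
  IsSensePreservingHarmonic f ∧ Set.InjOn f (Metric.ball 0 1) ∧
    ∀ r : ℝ, 0 < r → r < 1 → IsSpirallikeDomain lam (f '' Metric.ball 0 r)

/-- `A_n = |1 + n e^{-i lam}| + |1 - n e^{-i lam}|`. -/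
def constA (lam : ℝ) (n : ℕ) : ℝ :=
  ‖1 + (n : ℂ) * Complex.exp (-(Complex.I * lam))‖
    + ‖1 - (n : ℂ) * Complex.exp (-(Complex.I * lam))‖

/-- `B = |1 + e^{-i lam}| - |1 - e^{-i lam}|`. -/
def constB (lam : ℝ) : ℝ :=
  ‖1 + Complex.exp (-(Complex.I * lam))‖ - ‖1 - Complex.exp (-(Complex.I * lam))‖

end HarmonicSpirallike

end

open HarmonicSpirallike

/-! Everything passes through the weighted sum `∑ n (|a_n| + |b_n|)`. When the coefficients are
`-|a_n|` and `|b_n|`, both derivatives are real on `[0, 1)`, and positivity of the Jacobian there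
forces `∑ n (|a_n| + |b_n|) ≤ 1` and `|b_1| < 1` (`coeffNorm_bound_of_sensePreserving`).

Conversely, `∑ A_n (|a_n| + |b_n|) ≤ B` with `A_1 |b_1| < B` implies hereditary spirallikeness
(`isHereditarilySpirallike_of_coeffNorm`). As `A_n ≥ 2n` and `B ≤ 2`, the map is the identity plus a
strict contraction on each smaller disk, hence univalent and sense-preserving. With `D = z h' - conj
(z g')` and `ω = e^{-iλ}`, the same inequality gives `|f - ωD| < |f + ωD|`, that is `Re (e^{iλ} f
conj D) > 0` (`spiral_re_pos`). This says that the flow `w' = -e^{iλ} w` crosses the image of each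
circle inwards, so it cannot leave `f(𝔻_r)` (`spiral_mem_image_ball`).

The bound on `d_n` converts weights `n` into weights `A_n`. For `λ = 0` one has `A_n = 2n`, `B = 2`,
and spirals are radii, which gives the converse half. -/

namespace HarmonicSpirallike

/-! ### Power series in the disk and their termwise derivatives -/

/-- The sequence `c` with its first `k` terms replaced by zero. -/
def truncBelow {R : Type*} [Zero R] (k : ℕ) (c : ℕ → R) (n : ℕ) : R := if k ≤ n then c n else 0

/-- The sum of the power series with coefficients `c`. -/
noncomputable def powerSum (c : ℕ → ℂ) (z : ℂ) : ℂ := ∑' n : ℕ, c n * z ^ n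

/-- The sum of the termwise derivative of the power series with coefficients `c`. -/
noncomputable def derivSum (c : ℕ → ℂ) (z : ℂ) : ℂ := ∑' n : ℕ, c n * (n * z ^ (n - 1))

/-- The power series with coefficients `c` converges in the open unit disk. -/
def ConvergesInDisk (c : ℕ → ℂ) : Prop :=
  ∀ z ∈ Metric.ball (0 : ℂ) 1, Summable (fun n : ℕ => c n * z ^ n)

lemma truncBelow_support_subset (k : ℕ) (c : ℕ → ℂ) (z : ℂ) :
    Function.support (fun n => truncBelow k c n * z ^ n) ⊆ Set.range (fun n : ℕ => n + k) := by
  intro n hn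
  by_cases h : k ≤ n
  · exact ⟨n - k, Nat.sub_add_cancel h⟩
  · simp [truncBelow, h] at hn

lemma tsum_shift_eq_powerSum (k : ℕ) (c : ℕ → ℂ) (z : ℂ) :
    ∑' n : ℕ, c (n + k) * z ^ (n + k) = powerSum (truncBelow k c) z := by
  rw [powerSum, ← (add_left_injective k).tsum_eq (truncBelow_support_subset k c z)]
  simp [truncBelow]

lemma summable_shift_iff (k : ℕ) (c : ℕ → ℂ) (z : ℂ) :
    Summable (fun n : ℕ => c (n + k) * z ^ (n + k)) ↔
      Summable (fun n => truncBelow k c n * z ^ n) := by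
  rw [← (add_left_injective k).summable_iff (f := fun n => truncBelow k c n * z ^ n)]
  · simp [truncBelow, Function.comp_def]
  · intro n hn
    by_contra h
    exact hn (truncBelow_support_subset k c z h)

lemma seriesConverges_iff (a b : ℕ → ℂ) :
    SeriesConverges a b ↔
      ConvergesInDisk (truncBelow 2 a) ∧ ConvergesInDisk (truncBelow 1 b) := by
  simp only [SeriesConverges, ConvergesInDisk, summable_shift_iff]
  exact ⟨fun h => ⟨fun z hz => (h z hz).1, fun z hz => (h z hz).2⟩,
    fun h z hz => ⟨h.1 z hz, h.2 z hz⟩⟩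

lemma harmonicSeries_eq (a b : ℕ → ℂ) (z : ℂ) :
    harmonicSeries a b z =
      (z + powerSum (truncBelow 2 a) z) + (starRingEnd ℂ) (powerSum (truncBelow 1 b) z) := by
  simp only [harmonicSeries, tsum_shift_eq_powerSum]

/-- The convex function `x ^ n` lies above its tangent at `r`. Hence `n r ^ (n - 1) ≤ s ^ n / (s -
r)`, so convergence at `s` controls the derived series at any smaller `r`. -/
lemma mul_pow_mul_sub_add_pow_le {r s : ℝ} (hr : 0 ≤ r) (hrs : r ≤ s) (n : ℕ) :
    n * r ^ (n - 1) * (s - r) + r ^ n ≤ s ^ n := by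
  induction n with
  | zero => simp
  | succ n ih =>
    have e : (n : ℝ) * r ^ (n - 1) * r = n * r ^ n := by
      cases n with
      | zero => simp
      | succ m => simp [pow_succ, mul_assoc]
    have h1 : r ^ n ≤ s ^ n := pow_le_pow_left₀ hr hrs n
    have h2 := mul_le_mul_of_nonneg_left ih hr
    have h3 := mul_le_mul_of_nonneg_right h1 (sub_nonneg.2 hrs)
    have e2 : r * (n * r ^ (n - 1) * (s - r) + r ^ n) = n * r ^ n * (s - r) + r ^ n * r := by
      rw [← e]; ring
    push_cast [Nat.add_sub_cancel]
    rw [pow_succ, pow_succ]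
    rw [e2] at h2
    nlinarith

lemma ConvergesInDisk.summable_deriv {c : ℕ → ℂ} (hc : ConvergesInDisk c) {r : ℝ} (hr : 0 ≤ r)
    (hr1 : r < 1) : Summable (fun n : ℕ => ‖c n‖ * (n * r ^ (n - 1))) := by
  obtain ⟨s, hrs, hs1⟩ := exists_between hr1
  have hs : 0 ≤ s := hr.trans hrs.le
  have h := (hc (s : ℂ) (by simpa [abs_of_nonneg hs] using hs1)).norm
  simp only [norm_mul, norm_pow, Complex.norm_real, Real.norm_eq_abs, abs_of_nonneg hs] at h
  refine Summable.of_nonneg_of_le (fun n => by positivity) (fun n => ?_) (h.mul_right (s - r)⁻¹)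
  rw [mul_assoc]
  refine mul_le_mul_of_nonneg_left ?_ (norm_nonneg _)
  rw [← div_eq_mul_inv, le_div_iff₀ (sub_pos.2 hrs)]
  have := mul_pow_mul_sub_add_pow_le hr hrs.le n
  have := pow_nonneg hr n
  linarith

lemma ConvergesInDisk.hasDerivAt {c : ℕ → ℂ} (hc : ConvergesInDisk c) {z : ℂ} (hz : ‖z‖ < 1) :
    HasDerivAt (powerSum c) (derivSum c z) z := by
  obtain ⟨s, hzs, hs1⟩ := exists_between hz
  have hs : 0 ≤ s := (norm_nonneg z).trans hzs.le
  refine hasDerivAt_tsum_of_isPreconnected (t := Metric.ball 0 s)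
    (g := fun n y => c n * y ^ n) (g' := fun n y => c n * (n * y ^ (n - 1))) (y₀ := z)
    (hc.summable_deriv hs hs1) Metric.isOpen_ball (convex_ball _ _).isPreconnected
    (fun n y _ => ?_) (fun n y hy => ?_) (by simpa using hzs) (hc z (by simpa using hz))
    (by simpa using hzs)
  · exact (hasDerivAt_pow n y).const_mul (c n)
  · rw [mem_ball_zero_iff] at hy
    simp only [norm_mul, norm_pow, Complex.norm_natCast]
    gcongr

lemma ConvergesInDisk.differentiableOn {c : ℕ → ℂ} (hc : ConvergesInDisk c) :
    DifferentiableOn ℂ (powerSum c) (Metric.ball 0 1) := fun _ hz =>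
  (hc.hasDerivAt (mem_ball_zero_iff.1 hz)).differentiableAt.differentiableWithinAt

lemma ConvergesInDisk.norm_derivSum_le {c : ℕ → ℂ} (hc : ConvergesInDisk c) {r : ℝ}
    (hr1 : r < 1) {z : ℂ} (hz : ‖z‖ ≤ r) :
    ‖derivSum c z‖ ≤ ∑' n : ℕ, ‖c n‖ * (n * r ^ (n - 1)) := by
  refine tsum_of_norm_bounded (hc.summable_deriv ((norm_nonneg z).trans hz) hr1).hasSum
    fun n => ?_
  simp only [norm_mul, norm_pow, Complex.norm_natCast]
  gcongr

lemma ConvergesInDisk.continuousOn_derivSum {c : ℕ → ℂ} (hc : ConvergesInDisk c) :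
    ContinuousOn (derivSum c) (Metric.ball 0 1) := by
  have h := (hc.differentiableOn.deriv Metric.isOpen_ball).continuousOn
  exact h.congr fun z hz => (hc.hasDerivAt (mem_ball_zero_iff.1 hz)).deriv.symm

lemma derivSum_ofReal (x : ℕ → ℝ) (r : ℝ) :
    derivSum (fun n => (x n : ℂ)) r = ((∑' n : ℕ, x n * (n * r ^ (n - 1)) : ℝ) : ℂ) := by
  rw [derivSum, Complex.ofReal_tsum]
  push_cast
  rfl

lemma convergesInDisk_of_summable_norm {c : ℕ → ℂ} (hc : Summable fun n : ℕ => ‖c n‖) :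
    ConvergesInDisk c := by
  intro z hz
  refine Summable.of_norm_bounded hc fun n => ?_
  rw [norm_mul, norm_pow]
  exact mul_le_of_le_one_right (norm_nonneg _)
    (pow_le_one₀ (norm_nonneg _) (mem_ball_zero_iff.1 hz).le)

/-- If a nonnegative series starting at index one has sum at most `C` and its first term is less
than `C`, then inserting the weights `r ^ (n - 1)` makes the sum less than `C`. -/
lemma tsum_mul_pow_pred_lt {x : ℕ → ℝ} (hx : ∀ n, 0 ≤ x n) (h0 : x 0 = 0) (hs : Summable x)
    {C : ℝ} (hC : ∑' n, x n ≤ C) (h1 : x 1 < C) {r : ℝ} (hr : 0 ≤ r) (hr1 : r < 1) :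
    Summable (fun n => x n * r ^ (n - 1)) ∧ ∑' n, x n * r ^ (n - 1) < C := by
  have hS : Summable (fun n => x n * r ^ (n - 1)) :=
    Summable.of_nonneg_of_le (fun n => mul_nonneg (hx n) (pow_nonneg hr _))
      (fun n => mul_le_of_le_one_right (hx n) (pow_le_one₀ hr hr1.le)) hs
  refine ⟨hS, ?_⟩
  have e1 := hs.sum_add_tsum_nat_add 2
  have e2 := hS.sum_add_tsum_nat_add 2
  simp only [Finset.sum_range_succ, Finset.sum_range_zero, h0] at e1 e2
  have hle : ∑' n, x (n + 2) * r ^ (n + 2 - 1) ≤ ∑' n, x (n + 2) * r := by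
    refine Summable.tsum_le_tsum (fun n => ?_) ((summable_nat_add_iff 2).2 hS)
      (((summable_nat_add_iff 2).2 hs).mul_right r)
    refine mul_le_mul_of_nonneg_left ?_ (hx _)
    exact pow_le_of_le_one hr hr1.le (by omega)
  rw [tsum_mul_right] at hle
  simp only [Nat.sub_self, pow_zero, mul_one, zero_mul, zero_add] at e1 e2
  have hT : (∑' n, x (n + 2)) * r ≤ (C - x 1) * r :=
    mul_le_mul_of_nonneg_right (by linarith) hr
  have hlt : (C - x 1) * r < C - x 1 := mul_lt_of_lt_one_right (sub_pos.2 h1) hr1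
  linarith

/-! ### The real differential of a harmonic function -/

/-- The real-linear map `v ↦ p * v + conj (q * v)`, the differential of a harmonic function
`h + conj g` with `h' = p` and `g' = q`. -/
noncomputable def harmonicDifferential (p q : ℂ) : ℂ →L[ℝ] ℂ :=
  (ContinuousLinearMap.toSpanSingleton ℂ p).restrictScalars ℝ +
    (Complex.conjCLE : ℂ →L[ℝ] ℂ).comp
      ((ContinuousLinearMap.toSpanSingleton ℂ q).restrictScalars ℝ)

@[simp] lemma harmonicDifferential_apply (p q v : ℂ) :
    harmonicDifferential p q v = p * v + (starRingEnd ℂ) (q * v) := by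
  simp [harmonicDifferential, mul_comm]

lemma harmonicDifferential_injective {p q : ℂ} (h : ‖q‖ < ‖p‖) :
    Function.Injective (harmonicDifferential p q) := by
  rw [injective_iff_map_eq_zero]
  intro v hv
  rw [harmonicDifferential_apply, add_eq_zero_iff_eq_neg] at hv
  have := congrArg norm hv
  rw [norm_neg, Complex.norm_conj, norm_mul, norm_mul] at this
  by_contra hv0
  exact h.ne' (mul_right_cancel₀ (norm_ne_zero_iff.2 hv0) this)

/-- The differential of a sense-preserving harmonic function as a linear equivalence. -/
noncomputable def harmonicDifferentialEquiv {p q : ℂ} (h : ‖q‖ < ‖p‖) : ℂ ≃L[ℝ] ℂ :=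
  (LinearEquiv.ofInjectiveEndo (harmonicDifferential p q : ℂ →ₗ[ℝ] ℂ)
    (harmonicDifferential_injective h)).toContinuousLinearEquiv

lemma harmonicDifferentialEquiv_apply {p q : ℂ} (h : ‖q‖ < ‖p‖) (v : ℂ) :
    harmonicDifferentialEquiv h v = p * v + (starRingEnd ℂ) (q * v) := by
  rw [← harmonicDifferential_apply]
  rfl

lemma coe_harmonicDifferentialEquiv {p q : ℂ} (h : ‖q‖ < ‖p‖) :
    (harmonicDifferentialEquiv h : ℂ →L[ℝ] ℂ) = harmonicDifferential p q := by
  rfl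

/-- The values at `1` and `i` give `p + conj q` and `p - conj q`, which separates the linear part
from the antilinear one. -/
lemma harmonicDifferential_inj {p q p' q' : ℂ}
    (h : harmonicDifferential p q = harmonicDifferential p' q') : p = p' ∧ q = q' := by
  have h1 := DFunLike.congr_fun h 1
  have h2 := DFunLike.congr_fun h Complex.I
  simp only [harmonicDifferential_apply, mul_one, map_mul, Complex.conj_I] at h1 h2
  have h3 : p - (starRingEnd ℂ) q = p' - (starRingEnd ℂ) q' := by
    apply mul_left_cancel₀ Complex.I_ne_zero
    linear_combination h2
  have hp : p = p' := by linear_combination (h1 + h3) / 2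
  refine ⟨hp, (starRingEnd ℂ).injective ?_⟩
  linear_combination (h1 - h3) / 2

lemma hasStrictFDerivAt_harmonic {h g : ℂ → ℂ} (hh : DifferentiableOn ℂ h (Metric.ball 0 1))
    (hg : DifferentiableOn ℂ g (Metric.ball 0 1)) {z : ℂ} (hz : z ∈ Metric.ball (0 : ℂ) 1) :
    HasStrictFDerivAt (fun z => h z + (starRingEnd ℂ) (g z))
      (harmonicDifferential (deriv h z) (deriv g z)) z := by
  have hU := Metric.isOpen_ball.mem_nhds hz
  have h1 := (hh.analyticAt hU).hasStrictDerivAt.hasStrictFDerivAt.restrictScalars ℝ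
  have h2 := (hg.analyticAt hU).hasStrictDerivAt.hasStrictFDerivAt.restrictScalars ℝ
  exact h1.add ((Complex.conjCLE : ℂ →L[ℝ] ℂ).hasStrictFDerivAt.comp z h2)

/-- The analytic and co-analytic parts of a harmonic function have uniquely determined
derivatives. -/
lemma deriv_eq_of_harmonic_eqOn {h g h' g' : ℂ → ℂ}
    (hh : DifferentiableOn ℂ h (Metric.ball 0 1)) (hg : DifferentiableOn ℂ g (Metric.ball 0 1))
    (hh' : DifferentiableOn ℂ h' (Metric.ball 0 1))
    (hg' : DifferentiableOn ℂ g' (Metric.ball 0 1))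
    (he : ∀ z ∈ Metric.ball (0 : ℂ) 1,
      h z + (starRingEnd ℂ) (g z) = h' z + (starRingEnd ℂ) (g' z))
    {z : ℂ} (hz : z ∈ Metric.ball (0 : ℂ) 1) : deriv h z = deriv h' z ∧ deriv g z = deriv g' z := by
  have h1 := (hasStrictFDerivAt_harmonic hh hg hz).hasFDerivAt
  have h2 := (hasStrictFDerivAt_harmonic hh' hg' hz).hasFDerivAt
  refine harmonicDifferential_inj (h1.unique (h2.congr_of_eventuallyEq ?_))
  filter_upwards [Metric.isOpen_ball.mem_nhds hz] with w hw using he w hw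

/-- Multiplication by the spiral direction moves the preimage inwards: if `D` and `V` satisfy
`Re (V * conj D) > 0`, the solution `v` of `p v + conj (q v) = -V` has `Re (v / z) < 0`. -/
lemma re_mul_conj_neg {p q z v V : ℂ} (hz : z ≠ 0) (hpq : ‖q‖ < ‖p‖)
    (hv : p * v + (starRingEnd ℂ) (q * v) = -V)
    (hV : 0 < (V * (starRingEnd ℂ) (z * p - (starRingEnd ℂ) (z * q))).re) :
    (v * (starRingEnd ℂ) z).re < 0 := by
  obtain ⟨u, rfl⟩ : ∃ u, v = u * z := ⟨v / z, by field_simp⟩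
  have hVe : V = -(p * (u * z) + (starRingEnd ℂ) (q * (u * z))) := by rw [hv, neg_neg]
  have hsq : ‖q‖ ^ 2 < ‖p‖ ^ 2 := by gcongr
  rw [← Complex.normSq_eq_norm_sq, ← Complex.normSq_eq_norm_sq] at hsq
  -- The mixed terms in `p q` are conjugate to each other and cancel in the real part; only `Re u`
  -- times the Jacobian remains.
  have key : (V * (starRingEnd ℂ) (z * p - (starRingEnd ℂ) (z * q))).re =
      -(u.re * (Complex.normSq z * (Complex.normSq p - Complex.normSq q))) := by
    rw [hVe]
    simp [Complex.normSq_apply]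
    ring
  have key2 : (u * z * (starRingEnd ℂ) z).re = u.re * Complex.normSq z := by
    simp [Complex.normSq_apply]
    ring
  rw [key] at hV
  rw [key2]
  have hzpos := Complex.normSq_pos.2 hz
  have hpos : 0 < Complex.normSq z * (Complex.normSq p - Complex.normSq q) :=
    mul_pos hzpos (sub_pos.2 hsq)
  have hu : u.re < 0 := by
    by_contra hu
    have := mul_nonneg (not_lt.1 hu) hpos.le
    linarith
  exact mul_neg_of_neg_of_pos hu hzpos

lemma deriv_nonneg_of_eventually_le_left {q : ℝ → ℝ} {q' t : ℝ} (hq : HasDerivAt q q' t)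
    (h : ∀ᶠ s in nhdsWithin t (Set.Iio t), q s ≤ q t) : 0 ≤ q' := by
  have := (hasDerivWithinAt_iff_tendsto_slope' (Set.notMem_Iio.2 le_rfl)).1
    (hq.hasDerivWithinAt (s := Set.Iio t))
  refine ge_of_tendsto this ?_
  filter_upwards [h, self_mem_nhdsWithin] with s hs hst
  rw [slope_def_field]
  rw [Set.mem_Iio] at hst
  have := div_nonneg (sub_nonneg.2 hs) (sub_nonneg.2 hst.le)
  rwa [← neg_sub, ← neg_sub t s, neg_div_neg_eq]

/-! ### Images of disks and invariance under the spiral flow -/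

section Geometry

variable {h g : ℂ → ℂ} {f : ℂ → ℂ}

lemma isOpen_image_of_sensePreserving (hh : DifferentiableOn ℂ h (Metric.ball 0 1))
    (hg : DifferentiableOn ℂ g (Metric.ball 0 1))
    (hf : f = fun z => h z + (starRingEnd ℂ) (g z))
    (hJ : ∀ z ∈ Metric.ball (0 : ℂ) 1, ‖deriv g z‖ < ‖deriv h z‖) {U : Set ℂ} (hU : IsOpen U)
    (hUD : U ⊆ Metric.ball 0 1) : IsOpen (f '' U) := by
  rw [isOpen_iff_mem_nhds]
  rintro _ ⟨z, hz, rfl⟩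
  have hd := hasStrictFDerivAt_harmonic hh hg (hUD hz)
  rw [← hf, ← coe_harmonicDifferentialEquiv (hJ z (hUD hz))] at hd
  rw [← hd.map_nhds_eq_of_equiv]
  exact Filter.image_mem_map (hU.mem_nhds hz)

lemma continuousOn_harmonic (hh : DifferentiableOn ℂ h (Metric.ball 0 1))
    (hg : DifferentiableOn ℂ g (Metric.ball 0 1))
    (hf : f = fun z => h z + (starRingEnd ℂ) (g z)) : ContinuousOn f (Metric.ball 0 1) := by
  rw [hf]
  exact hh.continuousOn.add (Complex.continuous_conj.comp_continuousOn hg.continuousOn)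

lemma closure_image_ball_subset (hc : ContinuousOn f (Metric.ball 0 1)) {r : ℝ} (hr1 : r < 1) :
    closure (f '' Metric.ball 0 r) ⊆ f '' Metric.closedBall 0 r := by
  refine closure_minimal (Set.image_mono Metric.ball_subset_closedBall) ?_
  exact ((isCompact_closedBall 0 r).image_of_continuousOn
    (hc.mono (Metric.closedBall_subset_ball hr1))).isClosed

lemma frontier_image_ball (hc : ContinuousOn f (Metric.ball 0 1))
    (hinj : Set.InjOn f (Metric.ball 0 1)) {r : ℝ} (hr : 0 < r) (hr1 : r < 1)
    (ho : IsOpen (f '' Metric.ball 0 r)) :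
    frontier (f '' Metric.ball 0 r) = f '' Metric.sphere 0 r := by
  have hcl : closure (f '' Metric.ball 0 r) = f '' Metric.closedBall 0 r := by
    refine (closure_image_ball_subset hc hr1).antisymm ?_
    rw [← closure_ball (0 : ℂ) hr.ne']
    refine ContinuousOn.image_closure (hc.mono ?_)
    rw [closure_ball (0 : ℂ) hr.ne']
    exact Metric.closedBall_subset_ball hr1
  rw [ho.frontier_eq, hcl, ← Metric.closedBall_sdiff_ball,
    (hinj.mono (Metric.closedBall_subset_ball hr1)).image_sdiff_subset Metric.ball_subset_closedBall]

lemma isDomainSet_image_ball (hc : ContinuousOn f (Metric.ball 0 1)) {r : ℝ} (hr : 0 < r)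
    (hr1 : r < 1) (ho : IsOpen (f '' Metric.ball 0 r)) : IsDomainSet (f '' Metric.ball 0 r) := by
  refine ⟨ho, ?_⟩
  exact ((convex_ball (0 : ℂ) r).isConnected (Metric.nonempty_ball.2 hr)).image f
    (hc.mono (Metric.ball_subset_ball hr1.le))

/-- A trajectory of the flow `w' = -κ w` starting in `f (𝔻_r)` never leaves it, provided
`κ f` points out of the image of every circle `|z| = r`. -/
lemma spiral_mem_image_ball (hh : DifferentiableOn ℂ h (Metric.ball 0 1))
    (hg : DifferentiableOn ℂ g (Metric.ball 0 1))
    (hf : f = fun z => h z + (starRingEnd ℂ) (g z))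
    (hJ : ∀ z ∈ Metric.ball (0 : ℂ) 1, ‖deriv g z‖ < ‖deriv h z‖)
    (hinj : Set.InjOn f (Metric.ball 0 1)) {κ : ℂ} {r : ℝ} (hr : 0 < r) (hr1 : r < 1)
    (hκ : ∀ z ∈ Metric.sphere (0 : ℂ) r,
      0 < (κ * f z * (starRingEnd ℂ) (z * deriv h z - (starRingEnd ℂ) (z * deriv g z))).re)
    {w : ℂ} (hw : w ∈ f '' Metric.ball 0 r) {t : ℝ} (ht : 0 ≤ t) :
    w * Complex.exp (-(κ * t)) ∈ f '' Metric.ball 0 r := by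
  have ho := isOpen_image_of_sensePreserving hh hg hf hJ Metric.isOpen_ball
    (Metric.ball_subset_ball hr1.le : Metric.ball (0 : ℂ) r ⊆ _)
  set γ : ℝ → ℂ := fun s => w * Complex.exp (-(κ * s)) with hγ
  have hγd : ∀ s, HasDerivAt γ (-(κ * γ s)) s := by
    intro s
    have h1 : HasDerivAt (fun s : ℝ => -(κ * (s : ℂ))) (-(κ * 1)) s :=
      ((Complex.ofRealCLM.hasDerivAt (x := s)).const_mul κ).neg
    refine (h1.cexp.const_mul w).congr_deriv ?_
    simp only [hγ]
    ring
  have hγc : Continuous γ := continuous_iff_continuousAt.2 fun s => (hγd s).continuousAt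
  by_contra hbad
  -- The times spent outside the open image form a closed set, so its infimum `τ` is attained: it is
  -- the first exit time.
  let T : Set ℝ := Set.Ici 0 ∩ γ ⁻¹' (f '' Metric.ball 0 r)ᶜ
  have hTc : IsClosed T := isClosed_Ici.inter (ho.isClosed_compl.preimage hγc)
  have hTb : BddBelow T := ⟨0, fun s hs => hs.1⟩
  obtain ⟨ht0, ht0'⟩ := hTc.csInf_mem ⟨t, ht, hbad⟩ hTb
  set τ := sInf T
  have hτ : 0 < τ := by
    refine lt_of_le_of_ne ht0 fun h0 => ht0' ?_
    rw [← h0]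
    simpa [hγ] using hw
  have hlt : ∀ᶠ s in nhdsWithin τ (Set.Iio τ), γ s ∈ f '' Metric.ball 0 r := by
    filter_upwards [self_mem_nhdsWithin, mem_nhdsWithin_of_mem_nhds (Ioi_mem_nhds hτ)]
      with s hs hs0
    by_contra hns
    exact (not_le.2 hs) (csInf_le hTb ⟨(Set.mem_Ioi.1 hs0).le, hns⟩)
  have hclos : γ τ ∈ closure (f '' Metric.ball 0 r) :=
    mem_closure_of_tendsto (hγc.continuousAt.mono_left nhdsWithin_le_nhds) hlt
  obtain ⟨z, hz, hzτ⟩ := closure_image_ball_subset (continuousOn_harmonic hh hg hf) hr1 hclos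
  have hzr : z ∈ Metric.sphere (0 : ℂ) r := by
    rw [← Metric.closedBall_sdiff_ball]
    exact ⟨hz, fun hzb => ht0' ⟨z, hzb, hzτ⟩⟩
  have hzD : z ∈ Metric.ball (0 : ℂ) 1 := Metric.closedBall_subset_ball hr1 hz
  have hz0 : z ≠ 0 := Metric.ne_of_mem_sphere hzr hr.ne'
  have hd := hasStrictFDerivAt_harmonic hh hg hzD
  rw [← hf, ← coe_harmonicDifferentialEquiv (hJ z hzD)] at hd
  set e := harmonicDifferentialEquiv (hJ z hzD) with he
  have hinv : HasFDerivAt (hd.localInverse f e z) (e.symm : ℂ →L[ℝ] ℂ) (γ τ) := by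
    rw [← hzτ]
    exact hd.to_localInverse.hasFDerivAt
  -- The trajectory is pulled back near `τ` by the local inverse at the boundary preimage `z`; the
  -- outward condition makes `‖ζ‖ ^ 2` strictly decreasing at `τ`.
  set ζ : ℝ → ℂ := fun s => hd.localInverse f e z (γ s) with hζ
  have hζτ : ζ τ = z := by simp only [hζ, ← hzτ, hd.localInverse_apply_image]
  set v := e.symm (-(κ * γ τ)) with hv
  have hζd : HasDerivAt ζ v τ := hinv.comp_hasDerivAt τ (hγd τ)
  have hright : ∀ᶠ s in nhds τ, f (ζ s) = γ s := by
    have := hd.eventually_right_inverse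
    rw [hzτ] at this
    exact hγc.continuousAt.eventually this
  have hev : deriv h z * v + (starRingEnd ℂ) (deriv g z * v) = -(κ * f z) := by
    rw [← harmonicDifferentialEquiv_apply (hJ z hzD), ← he, hv, e.apply_symm_apply, hzτ]
  have hneg := re_mul_conj_neg hz0 (hJ z hzD) hev (hκ z hzr)
  have hq : HasDerivAt (fun s => ‖ζ s‖ ^ 2) (2 * inner ℝ (ζ τ) v) τ := hζd.norm_sq
  -- Before `τ` the trajectory is in `f(𝔻_r)`, and univalence identifies `ζ s` with the preimage in
  -- `𝔻_r`. So `‖ζ‖` grows to `r` at `τ`, against the negative derivative.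
  have hle : ∀ᶠ s in nhdsWithin τ (Set.Iio τ), ‖ζ s‖ ^ 2 ≤ ‖ζ τ‖ ^ 2 := by
    have hD : ∀ᶠ s in nhds τ, ζ s ∈ Metric.ball (0 : ℂ) 1 :=
      hζd.continuousAt.eventually (by rw [hζτ]; exact Metric.isOpen_ball.mem_nhds hzD)
    filter_upwards [hlt, mem_nhdsWithin_of_mem_nhds hD, mem_nhdsWithin_of_mem_nhds hright]
      with s ⟨y, hy, hys⟩ hsD hs
    have : ζ s = y := hinj hsD (Metric.ball_subset_ball hr1.le hy) (by rw [hs, hys])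
    rw [this, hζτ, mem_sphere_zero_iff_norm.1 hzr]
    have := mem_ball_zero_iff.1 hy
    gcongr
  have := deriv_nonneg_of_eventually_le_left hq hle
  rw [hζτ, Complex.inner] at this
  linarith

end Geometry

/-! ### The constants `A_n` and `B` -/

lemma norm_exp_neg_I_mul (lam : ℝ) : ‖Complex.exp (-(Complex.I * lam))‖ = 1 := by
  rw [Complex.norm_exp]
  simp

lemma two_mul_le_constA (lam : ℝ) (n : ℕ) : 2 * (n : ℝ) ≤ constA lam n := by
  have h := norm_sub_le (1 + (n : ℂ) * Complex.exp (-(Complex.I * lam)))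
    (1 - (n : ℂ) * Complex.exp (-(Complex.I * lam)))
  have e : (1 + (n : ℂ) * Complex.exp (-(Complex.I * lam))) -
      (1 - (n : ℂ) * Complex.exp (-(Complex.I * lam))) =
      2 * n * Complex.exp (-(Complex.I * lam)) := by ring
  rw [e, norm_mul, norm_exp_neg_I_mul] at h
  simpa [constA] using h

lemma constB_le_two (lam : ℝ) : constB lam ≤ 2 := by
  have h := norm_sub_norm_le (1 + Complex.exp (-(Complex.I * lam)))
    (1 - Complex.exp (-(Complex.I * lam)))
  have e : (1 + Complex.exp (-(Complex.I * lam))) - (1 - Complex.exp (-(Complex.I * lam))) =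
      2 * Complex.exp (-(Complex.I * lam)) := by ring
  rw [e, norm_mul, norm_exp_neg_I_mul] at h
  simpa [constB] using h

/-- Polarization: positivity of a real part becomes a comparison of two moduli. With `x = 1`, `y =
ω` it shows that `B` has the sign of `cos λ`. -/
lemma re_mul_conj_eq (x y : ℂ) :
    4 * (x * (starRingEnd ℂ) y).re = ‖x + y‖ ^ 2 - ‖x - y‖ ^ 2 := by
  rw [← Complex.normSq_eq_norm_sq, ← Complex.normSq_eq_norm_sq]
  simp [Complex.normSq_apply]
  ring

lemma constB_pos {lam : ℝ} (hlam : lam ∈ Set.Ioo (-(Real.pi / 2)) (Real.pi / 2)) :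
    0 < constB lam := by
  rw [constB, sub_pos]
  refine lt_of_pow_lt_pow_left₀ 2 (norm_nonneg _) (sub_pos.1 ?_)
  rw [← re_mul_conj_eq, one_mul, Complex.conj_re, Complex.exp_re]
  simpa using Real.cos_pos_of_mem_Ioo hlam

lemma constB_zero : constB 0 = 2 := by
  norm_num [constB]

lemma constA_zero {n : ℕ} (hn : 1 ≤ n) : constA 0 n = 2 * n := by
  have h1 : ‖(1 : ℂ) + n‖ = 1 + n := by
    rw [← Nat.cast_one, ← Nat.cast_add, Complex.norm_natCast]; push_cast; rfl
  have h2 : ‖(1 : ℂ) - n‖ = n - 1 := by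
    rw [norm_sub_rev, ← Nat.cast_one, ← Nat.cast_sub hn, Complex.norm_natCast, Nat.cast_sub hn,
      Nat.cast_one]
  simp only [constA, Complex.ofReal_zero, mul_zero, neg_zero, Complex.exp_zero, mul_one, h1, h2]
  ring

/-! ### Coefficient inequalities and their consequences -/

/-- The sum of the moduli of the coefficients of index `n` in `harmonicSeries a b`, apart from
the leading term. -/
noncomputable def coeffNorm (a b : ℕ → ℂ) (n : ℕ) : ℝ := ‖truncBelow 2 a n‖ + ‖truncBelow 1 b n‖

lemma coeffNorm_nonneg (a b : ℕ → ℂ) (n : ℕ) : 0 ≤ coeffNorm a b n := by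
  unfold coeffNorm; positivity

lemma coeffNorm_zero (a b : ℕ → ℂ) : coeffNorm a b 0 = 0 := by
  simp [coeffNorm, truncBelow]

lemma powerSum_apply_zero {c : ℕ → ℂ} (h : c 0 = 0) : powerSum c 0 = 0 := by
  rw [powerSum, tsum_eq_single 0]
  · simp [h]
  · intro n hn
    simp [hn]

lemma derivSum_apply_zero (c : ℕ → ℂ) : derivSum c 0 = c 1 := by
  rw [derivSum, tsum_eq_single 1]
  · simp
  · intro n hn
    rcases n with _ | _ | n
    · simp
    · exact absurd rfl hn
    · simp

section Series

variable {a b : ℕ → ℂ}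

lemma differentiableOn_add_powerSum (ha : ConvergesInDisk a) :
    DifferentiableOn ℂ (fun z => z + powerSum a z) (Metric.ball 0 1) :=
  differentiableOn_id.add ha.differentiableOn

lemma deriv_add_powerSum (ha : ConvergesInDisk a) {z : ℂ} (hz : ‖z‖ < 1) :
    deriv (fun z => z + powerSum a z) z = 1 + derivSum a z :=
  ((hasDerivAt_id z).add (ha.hasDerivAt hz)).deriv

/-- A sense-preserving `z - ∑ |a n| z ^ n + conj (∑ |b n| z ^ n)` satisfies the coefficient
inequality `∑ n (|a n| + |b n|) ≤ 1`. -/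
lemma coeffNorm_bound_of_sensePreserving
    (hc : SeriesConverges (fun n => -(‖a n‖ : ℂ)) (fun n => (‖b n‖ : ℂ)))
    (hf : IsSensePreservingHarmonic
      (harmonicSeries (fun n => -(‖a n‖ : ℂ)) (fun n => (‖b n‖ : ℂ)))) :
    Summable (fun n : ℕ => n * coeffNorm a b n) ∧ ∑' n : ℕ, n * coeffNorm a b n ≤ 1 ∧
      coeffNorm a b 1 < 1 := by
  obtain ⟨hA, hB⟩ := (seriesConverges_iff _ _).1 hc
  set x : ℕ → ℝ := fun n => ‖truncBelow 2 a n‖ with hx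
  set y : ℕ → ℝ := fun n => ‖truncBelow 1 b n‖ with hy
  have hxe : truncBelow 2 (fun n => -(‖a n‖ : ℂ)) = fun n => ((-x n : ℝ) : ℂ) := by
    funext n
    by_cases h : 2 ≤ n <;> simp [hx, truncBelow, h]
  have hye : truncBelow 1 (fun n => (‖b n‖ : ℂ)) = fun n => (y n : ℂ) := by
    funext n
    by_cases h : 1 ≤ n <;> simp [hy, truncBelow, h]
  have hser := harmonicSeries_eq (fun n => -(‖a n‖ : ℂ)) (fun n => (‖b n‖ : ℂ))
  rw [hxe] at hA hser
  rw [hye] at hB hser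
  obtain ⟨h, g, hh, hg, -, -, -, hfe, hJ⟩ := hf
  have hJ' : ∀ z : ℂ, ‖z‖ < 1 → ‖derivSum (fun n => (y n : ℂ)) z‖ <
      ‖1 + derivSum (fun n => ((-x n : ℝ) : ℂ)) z‖ := by
    intro z hz
    have hzD := mem_ball_zero_iff.2 hz
    -- The decomposition supplied by the hypothesis need not be the given series, but its
    -- derivatives must agree with theirs.
    obtain ⟨e1, e2⟩ := deriv_eq_of_harmonic_eqOn hh hg (differentiableOn_add_powerSum hA)
      hB.differentiableOn (fun w hw => by rw [← hfe w hw, hser]) hzD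
    have := hJ z hzD
    rw [e1, e2, deriv_add_powerSum hA hz, (hB.hasDerivAt hz).deriv] at this
    exact lt_of_pow_lt_pow_left₀ 2 (norm_nonneg _) (sub_pos.1 this)
  set X : ℝ → ℝ := fun r => ∑' n : ℕ, x n * (n * r ^ (n - 1)) with hX
  set Y : ℝ → ℝ := fun r => ∑' n : ℕ, y n * (n * r ^ (n - 1)) with hY
  have hX' : ∀ r : ℝ, 1 + derivSum (fun n => ((-x n : ℝ) : ℂ)) r = ((1 - X r : ℝ) : ℂ) := by
    intro r
    rw [derivSum_ofReal]
    simp only [neg_mul, tsum_neg, hX]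
    push_cast
    ring
  have hJr : ∀ r : ℝ, 0 ≤ r → r < 1 → |Y r| < |1 - X r| := by
    intro r hr hr1
    have := hJ' r (by simpa [abs_of_nonneg hr] using hr1)
    rwa [hX', derivSum_ofReal, Complex.norm_real, Complex.norm_real] at this
  have hX0 : X 0 = 0 := by
    have h0 := hX' 0
    rw [Complex.ofReal_zero, derivSum_apply_zero] at h0
    have : x 1 = 0 := by simp [hx, truncBelow]
    rw [this] at h0
    have h1 : (1 : ℝ) = 1 - X 0 := by exact_mod_cast (by simpa using h0 : (1 : ℂ) = 1 - X 0)
    linarith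
  -- `1 - X` equals `1` at `0` and cannot vanish, since `|1 - X| > |Y| ≥ 0`; by continuity it stays
  -- positive and the absolute value can be dropped.
  have hpos : ∀ r : ℝ, 0 ≤ r → r < 1 → 0 < 1 - X r := by
    intro r hr hr1
    by_contra hneg
    have hcont : ContinuousOn (fun s => 1 - X s) (Set.Icc 0 r) := by
      have h1 : ContinuousOn (fun s : ℝ => (1 + derivSum (fun n => ((-x n : ℝ) : ℂ)) s).re)
          (Set.Icc 0 r) := by
        refine Complex.continuous_re.comp_continuousOn (continuousOn_const.add ?_)
        refine hA.continuousOn_derivSum.comp Complex.continuous_ofReal.continuousOn ?_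
        intro s hs
        simpa [abs_of_nonneg hs.1] using hs.2.trans_lt hr1
      exact h1.congr fun s _ => by simp only [hX', Complex.ofReal_re]
    obtain ⟨s, hs, hs0⟩ := intermediate_value_Icc' hr hcont
      (show (0 : ℝ) ∈ Set.Icc (1 - X r) (1 - X 0) by
        rw [hX0]; exact ⟨not_lt.1 hneg, by norm_num⟩)
    have := hJr s hs.1 (hs.2.trans_lt hr1)
    simp only at hs0
    rw [hs0, abs_zero] at this
    exact absurd this (abs_nonneg _).not_gt
  have hbound : ∀ r : ℝ, 0 ≤ r → r < 1 → ∀ N : ℕ,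
      ∑ n ∈ Finset.range N, n * coeffNorm a b n * r ^ (n - 1) < 1 := by
    intro r hr hr1 N
    have hlt := (le_abs_self _).trans_lt (hJr r hr hr1)
    rw [abs_of_pos (hpos r hr hr1)] at hlt
    have hsx : Summable fun n : ℕ => x n * (n * r ^ (n - 1)) := by
      simpa [hx] using hA.summable_deriv hr hr1
    have hsy : Summable fun n : ℕ => y n * (n * r ^ (n - 1)) := by
      simpa [hy] using hB.summable_deriv hr hr1
    have h1 := hsx.sum_le_tsum (Finset.range N) (fun n _ => by positivity)
    have h2 := hsy.sum_le_tsum (Finset.range N) (fun n _ => by positivity)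
    have h3 : ∑ n ∈ Finset.range N, n * coeffNorm a b n * r ^ (n - 1) =
        ∑ n ∈ Finset.range N, x n * (n * r ^ (n - 1)) +
          ∑ n ∈ Finset.range N, y n * (n * r ^ (n - 1)) := by
      rw [← Finset.sum_add_distrib]
      refine Finset.sum_congr rfl fun n _ => ?_
      simp only [coeffNorm, hx, hy]
      ring
    rw [h3]
    linarith
  -- Finite sums are continuous in `r`, so `r → 1⁻` removes the powers at the price of strictness.
  have hpart : ∀ N : ℕ, ∑ n ∈ Finset.range N, n * coeffNorm a b n ≤ 1 := by
    intro N
    have hcont : Continuous fun r : ℝ =>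
        ∑ n ∈ Finset.range N, n * coeffNorm a b n * r ^ (n - 1) := by fun_prop
    have ht := (hcont.tendsto 1).mono_left (nhdsWithin_le_nhds (s := Set.Iio 1))
    simp only [one_pow, mul_one] at ht
    refine le_of_tendsto ht ?_
    filter_upwards [self_mem_nhdsWithin, mem_nhdsWithin_of_mem_nhds (Ioi_mem_nhds zero_lt_one)]
      with r hr1 hr0
    exact (hbound r (Set.mem_Ioi.1 hr0).le hr1 N).le
  have hnn : ∀ n : ℕ, 0 ≤ n * coeffNorm a b n := fun n =>
    mul_nonneg n.cast_nonneg (coeffNorm_nonneg a b n)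
  refine ⟨summable_of_sum_range_le hnn hpart, Real.tsum_le_of_sum_range_le hnn hpart, ?_⟩
  -- At `r = 0` only the term `n = 1` survives (`0 ^ 0 = 1`), and there the inequality is still
  -- strict.
  simpa [Finset.sum_range_succ] using hbound 0 le_rfl zero_lt_one 2

lemma summable_norm_of_coeffNorm {w : ℕ → ℝ} (hw : ∀ n : ℕ, (n : ℝ) ≤ w n)
    (hs : Summable fun n => w n * coeffNorm a b n) :
    Summable (fun n => ‖truncBelow 2 a n‖) ∧ Summable (fun n => ‖truncBelow 1 b n‖) := by
  have key : ∀ n, coeffNorm a b n ≤ w n * coeffNorm a b n := by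
    intro n
    rcases n.eq_zero_or_pos with rfl | hn
    · simp [coeffNorm_zero]
    · refine le_mul_of_one_le_left (coeffNorm_nonneg a b n) (le_trans ?_ (hw n))
      exact_mod_cast hn
  refine ⟨Summable.of_nonneg_of_le (fun n => norm_nonneg _) (fun n => le_trans ?_ (key n)) hs,
    Summable.of_nonneg_of_le (fun n => norm_nonneg _) (fun n => le_trans ?_ (key n)) hs⟩
  · exact le_add_of_nonneg_right (norm_nonneg _)
  · exact le_add_of_nonneg_left (norm_nonneg _)

/-- The left side is a Lipschitz constant of `f - id` on `|z| ≤ r`; its being below one yields both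
univalence and a positive Jacobian. -/
lemma tsum_deriv_add_tsum_deriv_lt (hA : ConvergesInDisk (truncBelow 2 a))
    (hB : ConvergesInDisk (truncBelow 1 b)) (hs : Summable fun n : ℕ => n * coeffNorm a b n)
    (hle : ∑' n : ℕ, n * coeffNorm a b n ≤ 1) (h1 : coeffNorm a b 1 < 1) {r : ℝ} (hr : 0 ≤ r)
    (hr1 : r < 1) :
    ∑' n : ℕ, ‖truncBelow 2 a n‖ * (n * r ^ (n - 1)) +
      ∑' n : ℕ, ‖truncBelow 1 b n‖ * (n * r ^ (n - 1)) < 1 := by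
  rw [← (hA.summable_deriv hr hr1).tsum_add (hB.summable_deriv hr hr1)]
  refine lt_of_eq_of_lt (tsum_congr fun n => ?_)
    (tsum_mul_pow_pred_lt (fun n => mul_nonneg n.cast_nonneg (coeffNorm_nonneg a b n)) (by simp)
      hs hle (by simpa using h1) hr hr1).2
  rw [coeffNorm]
  ring

lemma ConvergesInDisk.norm_powerSum_sub_le (ha : ConvergesInDisk a) {r : ℝ} (hr1 : r < 1)
    {z w : ℂ} (hz : ‖z‖ ≤ r) (hw : ‖w‖ ≤ r) :
    ‖powerSum a z - powerSum a w‖ ≤ (∑' n : ℕ, ‖a n‖ * (n * r ^ (n - 1))) * ‖z - w‖ :=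
  (convex_closedBall (0 : ℂ) r).norm_image_sub_le_of_norm_hasDerivWithin_le
    (fun _ hy => (ha.hasDerivAt ((mem_closedBall_zero_iff.1 hy).trans_lt hr1)).hasDerivWithinAt)
    (fun _ hy => ha.norm_derivSum_le hr1 (mem_closedBall_zero_iff.1 hy))
    (mem_closedBall_zero_iff.2 hw) (mem_closedBall_zero_iff.2 hz)

lemma injOn_harmonicSeries (hA : ConvergesInDisk (truncBelow 2 a))
    (hB : ConvergesInDisk (truncBelow 1 b)) (hs : Summable fun n : ℕ => n * coeffNorm a b n)
    (hle : ∑' n : ℕ, n * coeffNorm a b n ≤ 1) (h1 : coeffNorm a b 1 < 1) :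
    Set.InjOn (harmonicSeries a b) (Metric.ball 0 1) := by
  intro z hz w hw hzw
  rw [mem_ball_zero_iff] at hz hw
  have hr : 0 ≤ max ‖z‖ ‖w‖ := le_max_of_le_left (norm_nonneg _)
  have hr1 : max ‖z‖ ‖w‖ < 1 := max_lt hz hw
  have hk := tsum_deriv_add_tsum_deriv_lt hA hB hs hle h1 hr hr1
  have ea := hA.norm_powerSum_sub_le hr1 (le_max_left ‖z‖ ‖w‖) (le_max_right ‖z‖ ‖w‖)
  have eb := hB.norm_powerSum_sub_le hr1 (le_max_left ‖z‖ ‖w‖) (le_max_right ‖z‖ ‖w‖)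
  rw [harmonicSeries_eq, harmonicSeries_eq] at hzw
  have hsub : z - w = -((powerSum (truncBelow 2 a) z - powerSum (truncBelow 2 a) w) +
      (starRingEnd ℂ) (powerSum (truncBelow 1 b) z - powerSum (truncBelow 1 b) w)) := by
    rw [map_sub]
    linear_combination hzw
  have hn : ‖z - w‖ ≤ ‖powerSum (truncBelow 2 a) z - powerSum (truncBelow 2 a) w‖ +
      ‖powerSum (truncBelow 1 b) z - powerSum (truncBelow 1 b) w‖ := by
    conv_lhs => rw [hsub, norm_neg]
    refine (norm_add_le _ _).trans_eq ?_
    rw [Complex.norm_conj]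
  by_contra hne
  have hpos : 0 < ‖z - w‖ := norm_pos_iff.2 (sub_ne_zero.2 hne)
  have := mul_lt_mul_of_pos_right hk hpos
  linarith

lemma norm_derivSum_lt (hA : ConvergesInDisk (truncBelow 2 a))
    (hB : ConvergesInDisk (truncBelow 1 b)) (hs : Summable fun n : ℕ => n * coeffNorm a b n)
    (hle : ∑' n : ℕ, n * coeffNorm a b n ≤ 1) (h1 : coeffNorm a b 1 < 1) {z : ℂ} (hz : ‖z‖ < 1) :
    ‖derivSum (truncBelow 1 b) z‖ < ‖1 + derivSum (truncBelow 2 a) z‖ := by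
  have hk := tsum_deriv_add_tsum_deriv_lt hA hB hs hle h1 (norm_nonneg z) hz
  have ea := hA.norm_derivSum_le hz le_rfl
  have eb := hB.norm_derivSum_le hz le_rfl
  have := norm_sub_le (1 + derivSum (truncBelow 2 a) z) (derivSum (truncBelow 2 a) z)
  rw [add_sub_cancel_right, norm_one] at this
  linarith

lemma ConvergesInDisk.summable_linear (ha : ConvergesInDisk a) (μ ν : ℂ) {z : ℂ} (hz : ‖z‖ < 1) :
    Summable fun n : ℕ => ‖ν + n * μ‖ * (‖a n‖ * ‖z‖ ^ n) := by
  have h0 := (ha z (mem_ball_zero_iff.2 hz)).norm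
  have h1 := ha.summable_deriv (norm_nonneg z) hz
  refine Summable.of_nonneg_of_le (fun n => by positivity) (fun n => ?_)
    ((h0.mul_left ‖ν‖).add (h1.mul_left (‖μ‖ * ‖z‖)))
  have e : ‖ν‖ * ‖a n * z ^ n‖ + ‖μ‖ * ‖z‖ * (‖a n‖ * (n * ‖z‖ ^ (n - 1))) =
      (‖ν‖ + n * ‖μ‖) * (‖a n‖ * ‖z‖ ^ n) := by
    rcases n with _ | n
    · simp
    · simp only [norm_mul, norm_pow, Nat.add_sub_cancel, pow_succ]
      ring
  rw [e]
  gcongr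
  refine (norm_add_le _ _).trans_eq ?_
  rw [norm_mul, Complex.norm_natCast]

/-- Since `z d/dz` multiplies the `n`-th coefficient by `n`, the combination has coefficients `(ν +
n μ) a_n`. For `ν = 1`, `μ = ±ω` these multipliers have moduli summing to `A_n`. -/
lemma ConvergesInDisk.norm_linear_le (ha : ConvergesInDisk a) (μ ν : ℂ) {z : ℂ} (hz : ‖z‖ < 1) :
    ‖ν * powerSum a z + μ * (z * derivSum a z)‖ ≤
      ∑' n : ℕ, ‖ν + n * μ‖ * (‖a n‖ * ‖z‖ ^ n) := by
  have h0 : HasSum (fun n => a n * z ^ n) (powerSum a z) :=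
    (ha z (mem_ball_zero_iff.2 hz)).hasSum
  have h1 : HasSum (fun n : ℕ => a n * (n * z ^ (n - 1))) (derivSum a z) := by
    refine (Summable.of_norm ?_).hasSum
    simpa using ha.summable_deriv (norm_nonneg z) hz
  have h2 := (h0.mul_left ν).add ((h1.mul_left z).mul_left μ)
  rw [← h2.tsum_eq]
  refine tsum_of_norm_bounded (ha.summable_linear μ ν hz).hasSum fun n => le_of_eq ?_
  rw [← norm_pow, ← norm_mul, ← norm_mul]
  congr 1
  rcases n with _ | n
  · simp
  · simp only [Nat.add_sub_cancel, pow_succ]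
    ring

/-- The coefficient inequality `∑ A n (|a n| + |b n|) ≤ B` makes the real part of
`e ^ (-i lam) (z h' - conj (z g')) / f` positive. -/
lemma spiral_re_pos {lam : ℝ} (hA : ConvergesInDisk (truncBelow 2 a))
    (hB : ConvergesInDisk (truncBelow 1 b)) (hs : Summable fun n => constA lam n * coeffNorm a b n)
    (hle : ∑' n, constA lam n * coeffNorm a b n ≤ constB lam)
    (h1 : constA lam 1 * coeffNorm a b 1 < constB lam) {z : ℂ} (hz0 : z ≠ 0) (hz : ‖z‖ < 1) :
    0 < (Complex.exp (Complex.I * lam) * harmonicSeries a b z *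
      (starRingEnd ℂ) (z * (1 + derivSum (truncBelow 2 a) z) -
        (starRingEnd ℂ) (z * derivSum (truncBelow 1 b) z))).re := by
  set ω := Complex.exp (-(Complex.I * lam)) with hω
  have hωc : Complex.exp (Complex.I * lam) = (starRingEnd ℂ) ω := by
    rw [hω, ← Complex.exp_conj]
    simp
  set p := truncBelow 2 a
  set q := truncBelow 1 b
  set D := z * (1 + derivSum p z) - (starRingEnd ℂ) (z * derivSum q z) with hD
  have hre : Complex.exp (Complex.I * lam) * harmonicSeries a b z * (starRingEnd ℂ) D =
      harmonicSeries a b z * (starRingEnd ℂ) (ω * D) := by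
    rw [hωc, map_mul]; ring
  have hsq := re_mul_conj_eq (harmonicSeries a b z) (ω * D)
  rw [hre]
  suffices hlt : ‖harmonicSeries a b z - ω * D‖ < ‖harmonicSeries a b z + ω * D‖ by
    have : ‖harmonicSeries a b z - ω * D‖ ^ 2 < ‖harmonicSeries a b z + ω * D‖ ^ 2 := by gcongr
    linarith
  -- In the co-analytic part `ω` moves under the conjugation and becomes `conj ω`; the moduli of the
  -- multipliers do not change.
  have hconj : ∀ s : ℂ, ∀ n : ℕ, ‖1 + n * (starRingEnd ℂ) s‖ = ‖1 + n * s‖ := by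
    intro s n
    rw [← Complex.norm_conj]
    simp
  have pp := hA.norm_linear_le ω 1 hz
  have pm := hA.norm_linear_le (-ω) 1 hz
  have qp := hB.norm_linear_le ((starRingEnd ℂ) ω) 1 hz
  have qm := hB.norm_linear_le ((starRingEnd ℂ) (-ω)) 1 hz
  simp only [hconj] at qp qm
  have sp := hA.summable_linear ω 1 hz
  have sm := hA.summable_linear (-ω) 1 hz
  have tp := hB.summable_linear ω 1 hz
  have tm := hB.summable_linear (-ω) 1 hz
  have htot : ∑' n : ℕ, ‖1 + n * ω‖ * (‖p n‖ * ‖z‖ ^ n) + ∑' n : ℕ, ‖1 + n * -ω‖ * (‖p n‖ * ‖z‖ ^ n)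
      + (∑' n : ℕ, ‖1 + n * ω‖ * (‖q n‖ * ‖z‖ ^ n) + ∑' n : ℕ, ‖1 + n * -ω‖ * (‖q n‖ * ‖z‖ ^ n))
      = ‖z‖ * ∑' n : ℕ, constA lam n * coeffNorm a b n * ‖z‖ ^ (n - 1) := by
    rw [← sp.tsum_add sm, ← tp.tsum_add tm, ← (sp.add sm).tsum_add (tp.add tm), ← tsum_mul_left]
    refine tsum_congr fun n => ?_
    rcases n with _ | n
    · simp [coeffNorm_zero, p, q, truncBelow]
    · simp only [constA, coeffNorm, Nat.add_sub_cancel, pow_succ, mul_neg, ← sub_eq_add_neg, p, q,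
        hω]
      ring
  have hlt := (tsum_mul_pow_pred_lt
    (fun n => mul_nonneg (by unfold constA; positivity) (coeffNorm_nonneg a b n))
    (by rw [coeffNorm_zero, mul_zero]) hs hle h1 (norm_nonneg z) hz).2
  have hlt' := mul_lt_mul_of_pos_left hlt (norm_pos_iff.2 hz0)
  -- The leading terms of `f ± ωD` are `(1 ± ω) z`, whose moduli differ by `B |z|`. The remaining
  -- terms cost at most `|z| ∑ A_n (|a_n| + |b_n|) |z| ^ (n - 1)`, which is strictly less.
  have eplus : (1 + ω) * z = (harmonicSeries a b z + ω * D) -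
      (1 * powerSum p z + ω * (z * derivSum p z)) -
      (starRingEnd ℂ) (1 * powerSum q z + (starRingEnd ℂ) (-ω) * (z * derivSum q z)) := by
    rw [harmonicSeries_eq]
    simp only [hD, map_add, map_mul, map_neg, map_one, Complex.conj_conj]
    ring
  have eminus : harmonicSeries a b z - ω * D = (1 - ω) * z +
      (1 * powerSum p z + (-ω) * (z * derivSum p z)) +
      (starRingEnd ℂ) (1 * powerSum q z + (starRingEnd ℂ) ω * (z * derivSum q z)) := by
    rw [harmonicSeries_eq]
    simp only [hD, map_add, map_mul, map_one, Complex.conj_conj]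
    ring
  have nplus : ‖1 + ω‖ * ‖z‖ ≤ ‖harmonicSeries a b z + ω * D‖ +
      ‖1 * powerSum p z + ω * (z * derivSum p z)‖ +
      ‖1 * powerSum q z + (starRingEnd ℂ) (-ω) * (z * derivSum q z)‖ := by
    rw [← norm_mul, eplus]
    refine (norm_sub_le _ _).trans ?_
    rw [Complex.norm_conj]
    gcongr
    exact norm_sub_le _ _
  have nminus : ‖harmonicSeries a b z - ω * D‖ ≤ ‖1 - ω‖ * ‖z‖ +
      ‖1 * powerSum p z + (-ω) * (z * derivSum p z)‖ +
      ‖1 * powerSum q z + (starRingEnd ℂ) ω * (z * derivSum q z)‖ := by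
    rw [← norm_mul, eminus]
    refine (norm_add_le _ _).trans ?_
    rw [Complex.norm_conj]
    gcongr
    exact norm_add_le _ _
  have hBz : constB lam = ‖1 + ω‖ - ‖1 - ω‖ := rfl
  rw [hBz] at hlt'
  nlinarith

/-- The sufficient coefficient condition for hereditary spirallikeness. -/
lemma isHereditarilySpirallike_of_coeffNorm {lam : ℝ}
    (hs : Summable fun n => constA lam n * coeffNorm a b n)
    (hle : ∑' n, constA lam n * coeffNorm a b n ≤ constB lam)
    (h1 : constA lam 1 * coeffNorm a b 1 < constB lam) :
    SeriesConverges a b ∧ IsHereditarilySpirallike lam (harmonicSeries a b) ∧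
      ∀ r : ℝ, 0 < r → r < 1 → frontier (harmonicSeries a b '' Metric.ball 0 r) =
        harmonicSeries a b '' Metric.sphere 0 r := by
  have hn : ∀ n : ℕ, (n : ℝ) ≤ constA lam n / 2 := fun n => by
    linarith [two_mul_le_constA lam n]
  have hB2 := constB_le_two lam
  have hs2 : Summable fun n => constA lam n / 2 * coeffNorm a b n :=
    (hs.mul_left (1 / 2)).congr fun n => by ring
  have hmul : ∀ n : ℕ, n * coeffNorm a b n ≤ constA lam n / 2 * coeffNorm a b n := fun n =>
    mul_le_mul_of_nonneg_right (hn n) (coeffNorm_nonneg a b n)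
  have hs' : Summable fun n : ℕ => n * coeffNorm a b n :=
    Summable.of_nonneg_of_le (fun n => mul_nonneg n.cast_nonneg (coeffNorm_nonneg a b n)) hmul hs2
  have hle' : ∑' n : ℕ, n * coeffNorm a b n ≤ 1 := by
    refine (hs'.tsum_le_tsum hmul hs2).trans ?_
    have : ∑' n, constA lam n / 2 * coeffNorm a b n =
        1 / 2 * ∑' n, constA lam n * coeffNorm a b n := by
      rw [← tsum_mul_left]
      exact tsum_congr fun n => by ring
    rw [this]
    linarith
  have h1' : coeffNorm a b 1 < 1 := by
    have := hmul 1
    rw [Nat.cast_one, one_mul] at this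
    linarith
  obtain ⟨ca, cb⟩ := summable_norm_of_coeffNorm hn hs2
  have hA := convergesInDisk_of_summable_norm ca
  have hB := convergesInDisk_of_summable_norm cb
  have hinj := injOn_harmonicSeries hA hB hs' hle' h1'
  have hf : harmonicSeries a b = fun z => (fun z => z + powerSum (truncBelow 2 a) z) z +
      (starRingEnd ℂ) (powerSum (truncBelow 1 b) z) := funext fun z => harmonicSeries_eq a b z
  have hdh := differentiableOn_add_powerSum hA
  have hdg := hB.differentiableOn
  have hJ : ∀ z ∈ Metric.ball (0 : ℂ) 1, ‖deriv (powerSum (truncBelow 1 b)) z‖ <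
      ‖deriv (fun z => z + powerSum (truncBelow 2 a) z) z‖ := by
    intro z hz
    rw [mem_ball_zero_iff] at hz
    rw [deriv_add_powerSum hA hz, (hB.hasDerivAt hz).deriv]
    exact norm_derivSum_lt hA hB hs' hle' h1' hz
  have hc := continuousOn_harmonic hdh hdg hf
  have ho : ∀ r : ℝ, r < 1 → IsOpen (harmonicSeries a b '' Metric.ball 0 r) := fun r hr1 =>
    isOpen_image_of_sensePreserving hdh hdg hf hJ Metric.isOpen_ball
      (Metric.ball_subset_ball hr1.le)
  have ha0 : powerSum (truncBelow 2 a) 0 = 0 := powerSum_apply_zero (by simp [truncBelow])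
  have hb0 : powerSum (truncBelow 1 b) 0 = 0 := powerSum_apply_zero (by simp [truncBelow])
  refine ⟨(seriesConverges_iff a b).2 ⟨hA, hB⟩, ⟨?_, hinj, fun r hr hr1 => ?_⟩,
    fun r hr hr1 => frontier_image_ball hc hinj hr hr1 (ho r hr1)⟩
  · refine ⟨_, _, hdh, hdg, by simp [ha0], ?_, hb0, fun z _ => harmonicSeries_eq a b z,
      fun z hz => ?_⟩
    · rw [deriv_add_powerSum hA (by simp), derivSum_apply_zero]
      simp [truncBelow]
    · have := hJ z hz
      rw [sub_pos]
      gcongr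
  · refine ⟨isDomainSet_image_ball hc hr hr1 (ho r hr1),
      ⟨0, Metric.mem_ball_self hr, by simp [harmonicSeries_eq, ha0, hb0]⟩, fun w hw t ht => ?_⟩
    refine spiral_mem_image_ball hdh hdg hf hJ hinj hr hr1 (fun z hz => ?_) hw ht
    have hzr := mem_sphere_zero_iff_norm.1 hz
    have hz1 : ‖z‖ < 1 := hzr.trans_lt hr1
    rw [deriv_add_powerSum hA hz1, (hB.hasDerivAt hz1).deriv]
    exact spiral_re_pos hA hB hs hle h1 (Metric.ne_of_mem_sphere hz hr.ne') hz1

end Series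

/-! ### From spirals to radii, and the transfer of weights -/

lemma IsSpirallikeDomain.isStarlikeDomain {Ω : Set ℂ} (h : IsSpirallikeDomain 0 Ω) :
    IsStarlikeDomain Ω := by
  obtain ⟨hd, h0, hsp⟩ := h
  refine ⟨hd, h0, fun w hw s t hs ht hst => ?_⟩
  rw [smul_zero, zero_add]
  rcases ht.eq_or_lt with rfl | htpos
  · simpa using h0
  -- The `0`-spiral is `w e ^ (-s)`, so `s = -log t` reaches `t w`; the origin, never reached, was
  -- treated separately.
  have hmem := hsp w hw (-Real.log t) (neg_nonneg.2 (Real.log_nonpos ht (by linarith)))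
  have e : -(Complex.exp (Complex.I * (0 : ℝ)) * ((-Real.log t : ℝ) : ℂ)) =
      ((Real.log t : ℝ) : ℂ) := by simp
  rw [e, ← Complex.ofReal_exp, Real.exp_log htpos] at hmem
  rwa [Complex.real_smul, mul_comm]

lemma IsHereditarilySpirallike.isHereditarilyStarlike {f : ℂ → ℂ}
    (hf : IsHereditarilySpirallike 0 f)
    (hfr : ∀ r : ℝ, 0 < r → r < 1 → frontier (f '' Metric.ball 0 r) = f '' Metric.sphere 0 r) :
    IsHereditarilyStarlike f := by
  obtain ⟨hsp, hinj, hdom⟩ := hf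
  have hsub : ∀ {r : ℝ}, r < 1 → Metric.closedBall (0 : ℂ) r ⊆ Metric.ball 0 1 := fun hr1 =>
    Metric.closedBall_subset_ball hr1
  refine ⟨hsp, fun r hr hr1 => ⟨hinj.mono (Metric.sphere_subset_closedBall.trans (hsub hr1)),
    f '' Metric.ball 0 r, (hdom r hr hr1).isStarlikeDomain, ?_, hfr r hr hr1⟩, hinj⟩
  obtain ⟨h, g, hh, hg, -, -, -, hfe, -⟩ := hsp
  have hc : ContinuousOn f (Metric.ball 0 1) := (continuousOn_harmonic hh hg rfl).congr hfe
  exact ((isCompact_closedBall (0 : ℂ) r).image_of_continuousOn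
    (hc.mono (hsub hr1))).isBounded.subset (Set.image_mono Metric.ball_subset_closedBall)

lemma constA_mul_coeffNorm_le {lam : ℝ} {a b d : ℕ → ℂ}
    (hd : ∀ n : ℕ, 1 ≤ n → ‖d n‖ ≤ (n : ℝ) * constB lam / constA lam n) (n : ℕ) :
    constA lam n * coeffNorm (fun n => d n * a n) (fun n => d n * b n) n ≤
      constB lam * (n * coeffNorm a b n) := by
  rcases n.eq_zero_or_pos with rfl | hn
  · simp [coeffNorm_zero]
  have hpos : 0 < constA lam n := by
    have : (1 : ℝ) ≤ n := by exact_mod_cast hn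
    linarith [two_mul_le_constA lam n]
  have e : coeffNorm (fun n => d n * a n) (fun n => d n * b n) n = ‖d n‖ * coeffNorm a b n := by
    have h : ∀ (k : ℕ) (c : ℕ → ℂ),
        ‖truncBelow k (fun n => d n * c n) n‖ = ‖d n‖ * ‖truncBelow k c n‖ := by
      intro k c
      by_cases hk : k ≤ n <;> simp [truncBelow, hk]
    rw [coeffNorm, h, h, coeffNorm, mul_add]
  have := (le_div_iff₀ hpos).1 (hd n hn)
  rw [e]
  calc constA lam n * (‖d n‖ * coeffNorm a b n) = ‖d n‖ * constA lam n * coeffNorm a b n := by ring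
    _ ≤ n * constB lam * coeffNorm a b n :=
      mul_le_mul_of_nonneg_right this (coeffNorm_nonneg a b n)
    _ = constB lam * (n * coeffNorm a b n) := by ring

end HarmonicSpirallike

theorem mainTheorem7 (lam : ℝ) (hlam : lam ∈ Set.Ioo (-(Real.pi / 2)) (Real.pi / 2))
    (a b : ℕ → ℂ) :
    (SeriesConverges (fun n => -(‖a n‖ : ℂ)) (fun n => (‖b n‖ : ℂ)) →
      IsHereditarilyStarlike
        (harmonicSeries (fun n => -(‖a n‖ : ℂ)) (fun n => (‖b n‖ : ℂ))) →
      ∀ d : ℕ → ℂ, (∀ n : ℕ, 1 ≤ n → ‖d n‖ ≤ (n : ℝ) * constB lam / constA lam n) →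
        SeriesConverges (fun n => d n * a n) (fun n => d n * b n) ∧
        IsHereditarilySpirallike lam
          (harmonicSeries (fun n => d n * a n) (fun n => d n * b n))) ∧
    (SeriesConverges (fun n => -(‖a n‖ : ℂ)) (fun n => (‖b n‖ : ℂ)) →
      IsHereditarilySpirallike lam
        (harmonicSeries (fun n => -(‖a n‖ : ℂ)) (fun n => (‖b n‖ : ℂ))) →
      SeriesConverges a b ∧ IsHereditarilyStarlike (harmonicSeries a b)) := by
  refine ⟨fun hc hF d hd => ?_, fun hc hf => ?_⟩
  · obtain ⟨hs, hle, h1⟩ := coeffNorm_bound_of_sensePreserving hc hF.1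
    have hB := constB_pos hlam
    have hcmp := constA_mul_coeffNorm_le (a := a) (b := b) hd
    have hs' : Summable fun n =>
        constA lam n * coeffNorm (fun n => d n * a n) (fun n => d n * b n) n :=
      Summable.of_nonneg_of_le
        (fun n => mul_nonneg (by unfold constA; positivity) (coeffNorm_nonneg _ _ n)) hcmp
        (hs.mul_left (constB lam))
    obtain ⟨hcv, hsp, -⟩ := isHereditarilySpirallike_of_coeffNorm (lam := lam) hs' (by
      refine (hs'.tsum_le_tsum hcmp (hs.mul_left _)).trans ?_
      rw [tsum_mul_left]
      exact mul_le_of_le_one_right hB.le hle) (by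
      refine (hcmp 1).trans_lt ?_
      rw [Nat.cast_one, one_mul]
      exact mul_lt_of_lt_one_right hB h1)
    exact ⟨hcv, hsp⟩
  · obtain ⟨hs, hle, h1⟩ := coeffNorm_bound_of_sensePreserving hc hf.1
    -- At `n = 0` the constant is `2` and not `0`, but the coefficient vanishes there.
    have e : ∀ n, constA 0 n * coeffNorm a b n = 2 * (n * coeffNorm a b n) := by
      intro n
      rcases n.eq_zero_or_pos with rfl | hn
      · simp [coeffNorm_zero]
      · rw [constA_zero hn, mul_assoc]
    obtain ⟨hcv, hsp, hfr⟩ := isHereditarilySpirallike_of_coeffNorm (a := a) (b := b) (lam := 0)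
      ((hs.mul_left 2).congr fun n => (e n).symm) (by
      rw [tsum_congr e, tsum_mul_left, constB_zero]
      linarith) (by
      rw [e, constB_zero, Nat.cast_one]
      linarith)
    exact ⟨hcv, hsp.isHereditarilyStarlike hfr⟩
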